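/- Let $M$ be a II$_1$ factor (a von Neumann algebra with trivial center, infinite-dimensional, equipped with its faithful normal tracial state $\operatorname{tr}$), let $\|x\|_2=\operatorname{tr}(x^*x)^{1/2}$, and let $N\subseteq M$ be a (unital) von Neumann subalgebra. Regard $M$ as a many-sorted metric structure whose sorts are the operator norm balls of $M$ of natural number radius, each with the metric $d(x,y)=\|x-y\|_2$, equipped with the $*$-algebra operations and the trace. For $A\subseteq M$, a formula in $M$ over $A$ is a uniform limit in $M$ of first-order continuous-logic formulae with parameters from $A$. Writing $M_1$ for the operator norm unit ball, a von Neumann subalgebra $Q\subseteq M$ is called definable over $A$ if $Q\cap M_1$ is closed in $M_1$ and the function $x\mapsto d(x,Q\cap M_1)$ on $M_1$ is the interpretation of a formula in $M$ over $A$; it is definable if it is definable over some $A\subseteq M$ (equivalently, over $M$). (1) If $N$ is a definable subalgebra of $M$, then $N'\cap M=\{x\in M: xy=yx \text{ for all } y\in N\}$ is a definable subalgebra of $M$. More precisely, for every $A\subseteq M$, if $N$ is definable over $A$, then $N'\cap M$ is definable over $A$. (2) Suppose that $N$ has w-spectral gap in $M$: for every $\epsilon>0$ there are finitely many unitaries $u_1,\ldots,u_n\in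 N$ and $\delta>0$ such that, for all $x\in M_1$, if $\|xu_i-u_ix\|_2\le\delta$ for $i=1,\ldots,n$, then $\|x-\mathbb{E}_{N'\cap M}(x)\|_2\le\epsilon$, where $\mathbb{E}_{N'\cap M}$ is the orthogonal projection of $L^2(M)$ onto $L^2(N'\cap M)$. Then $(N'\cap M)'\cap M$ is a definable subalgebra of $M$; more precisely, it is definable over $N$. -/

import Mathlib

open scoped ComplexOrder
open Filter

/-! ### Tracial von Neumann algebras and II₁ factors -/

/-- A tracial von Neumann algebra: a von Neumann algebra `M ⊆ B(H)` with a normalized, positive,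
faithful, normal tracial functional `tr : M → ℂ`. Normality is continuity on the operator norm
unit ball of `M` for the weak operator topology. -/
structure TracialVNA (H : Type*) [NormedAddCommGroup H] [InnerProductSpace ℂ H]
    [CompleteSpace H] extends VonNeumannAlgebra H where
  tr : toStarSubalgebra →ₗ[ℂ] ℂ
  tr_one : tr 1 = 1
  tr_nonneg : ∀ x : toStarSubalgebra, 0 ≤ tr (star x * x)
  tr_faithful : ∀ x : toStarSubalgebra, tr (star x * x) = 0 ↔ x = 0
  tr_normal : @Continuous {x : toStarSubalgebra // ‖(x : H →L[ℂ] H)‖ ≤ 1} ℂ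
    (TopologicalSpace.induced
      (fun x => (ContinuousLinearMapWOT.ofCLM (x.1 : H →L[ℂ] H) : H →WOT[ℂ] H))
      inferInstance)
    inferInstance (fun x => tr x.1)
  tr_comm : ∀ x y : toStarSubalgebra, tr (x * y) = tr (y * x)

section RelativeCommutant

variable {H : Type*} [NormedAddCommGroup H] [InnerProductSpace ℂ H] [CompleteSpace H]

/-- The relative commutant `N' ∩ M`, as a von Neumann algebra on the same Hilbert space. -/
noncomputable def relCommutant (N M : VonNeumannAlgebra H) : VonNeumannAlgebra H where
  toStarSubalgebra := N.commutant.toStarSubalgebra ⊓ M.toStarSubalgebra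
  centralizer_centralizer' := by
    have h : (N.commutant.toStarSubalgebra ⊓ M.toStarSubalgebra).carrier
        = Set.centralizer ((N : Set (H →L[ℂ] H)) ∪ Set.centralizer (M : Set (H →L[ℂ] H))) := by
      rw [Set.centralizer_union, M.centralizer_centralizer, ← N.coe_commutant]
      rfl
    rw [h, Set.centralizer_centralizer_centralizer]

theorem mem_relCommutant {N M : VonNeumannAlgebra H} {x : H →L[ℂ] H} :
    x ∈ relCommutant N M ↔ (∀ y ∈ N, y * x = x * y) ∧ x ∈ M := by
  rw [← VonNeumannAlgebra.mem_commutant_iff]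
  exact Iff.rfl

end RelativeCommutant

namespace TracialVNA

variable {H : Type*} [NormedAddCommGroup H] [InnerProductSpace ℂ H] [CompleteSpace H]
  (M : TracialVNA H)

/-- `M` is a II₁ factor: its center consists of the scalars and it is infinite-dimensional (the
trace is part of the data of `M`). -/
def IsII1Factor : Prop :=
  (∀ x ∈ relCommutant M.toVonNeumannAlgebra M.toVonNeumannAlgebra,
    ∃ c : ℂ, x = c • (1 : H →L[ℂ] H)) ∧
  ¬ FiniteDimensional ℂ M.toStarSubalgebra

/-! ### The Hilbert space `L²(M)` -/

/-- A copy of `M`, carrying the inner product `⟪x, y⟫ = tr (x* y)` (linear in `y`) and its norm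
`‖x‖₂ = tr (x* x) ^ (1/2)`. -/
def L2Pre : Type _ := M.toStarSubalgebra

noncomputable instance : AddCommGroup M.L2Pre := inferInstanceAs (AddCommGroup M.toStarSubalgebra)
noncomputable instance : Module ℂ M.L2Pre := inferInstanceAs (Module ℂ M.toStarSubalgebra)

/-- The identity map from `M` to `M` with the `2`-norm. -/
noncomputable def toL2Pre : M.toStarSubalgebra ≃ₗ[ℂ] M.L2Pre := LinearEquiv.refl ℂ _

theorem tr_star (x : M.toStarSubalgebra) : M.tr (star x) = star (M.tr x) := by
  have key : ∀ c : ℂ, (c * M.tr x + star c * M.tr (star x)).im = 0 := by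
    intro c
    have h := M.tr_nonneg (1 + c • x)
    have h1 := M.tr_nonneg x
    have e : star (1 + c • x) * (1 + c • x)
        = 1 + c • x + star c • star x + (star c * c) • (star x * x) := by
      simp only [star_add, star_one, star_smul, add_mul, mul_add, one_mul, mul_one, smul_mul_assoc,
        mul_smul_comm]
      module
    rw [e] at h
    simp only [map_add, map_smul, tr_one, smul_eq_mul] at h
    have hi := (Complex.le_def.1 h).2
    have hi1 := (Complex.le_def.1 h1).2
    simp only [Complex.add_im, Complex.mul_im, Complex.mul_re, Complex.zero_im, Complex.one_im,
      Complex.star_def, Complex.conj_re, Complex.conj_im] at hi hi1 ⊢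
    rw [← hi1] at hi
    nlinarith
  have k1 := key 1
  have k2 := key Complex.I
  apply Complex.ext
  · simp at k2 ⊢
    linarith
  · simp at k1 ⊢
    linarith

noncomputable abbrev L2PreCore : InnerProductSpace.Core ℂ M.L2Pre where
  inner x y := M.tr (star (M.toL2Pre.symm x) * M.toL2Pre.symm y)
  conj_inner_symm x y := by
    rw [starRingEnd_apply, ← M.tr_star, star_mul, star_star]
  re_inner_nonneg x := (RCLike.nonneg_iff.mp (M.tr_nonneg _)).1
  add_left x y z := by rw [map_add, star_add, add_mul, map_add]
  smul_left x y c := by simp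
  definite x hx := by
    have h := (M.tr_faithful _).1 hx
    simpa using h

noncomputable instance : NormedAddCommGroup M.L2Pre :=
  InnerProductSpace.Core.toNormedAddCommGroup (cd := M.L2PreCore)
noncomputable instance : InnerProductSpace ℂ M.L2Pre :=
  InnerProductSpace.ofCore M.L2PreCore.toCore

/-- The norm `‖x‖₂` on `M`. -/
noncomputable def norm2 (x : M.toStarSubalgebra) : ℝ := ‖M.toL2Pre x‖

theorem norm2_eq (x : M.toStarSubalgebra) : M.norm2 x = √(M.tr (star x * x)).re := rfl

/-- The Hilbert space `L²(M)`, the completion of `M` in the `2`-norm. -/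
abbrev L2 : Type _ := UniformSpace.Completion M.L2Pre

/-- The inclusion of `M` in `L²(M)`. -/
noncomputable def toL2 : M.toStarSubalgebra →ₗ[ℂ] M.L2 :=
  (UniformSpace.Completion.toComplL : M.L2Pre →L[ℂ] M.L2).toLinearMap ∘ₗ M.toL2Pre.toLinearMap

/-- `L²(Q) ⊆ L²(M)`, the closure of `Q ∩ M` in `L²(M)`. -/
noncomputable def L2Sub (Q : VonNeumannAlgebra H) : Submodule ℂ M.L2 :=
  (((Q.toStarSubalgebra.toSubalgebra.toSubmodule).comap
    M.toStarSubalgebra.toSubalgebra.toSubmodule.subtype).map M.toL2).topologicalClosure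

noncomputable instance (Q : VonNeumannAlgebra H) : CompleteSpace (M.L2Sub Q) :=
  inferInstanceAs (CompleteSpace (Submodule.topologicalClosure _))

/-- `𝔼_Q`, the orthogonal projection of `L²(M)` onto `L²(Q)`. -/
noncomputable def condExp (Q : VonNeumannAlgebra H) : M.L2 →L[ℂ] M.L2 :=
  (M.L2Sub Q).starProjection

/-! ### `M` as a many-sorted metric structure -/

/-- The sort of radius `n`: the operator norm ball of radius `n` of `M`. -/
def Ball (n : ℕ) : Type _ := {x : M.toStarSubalgebra // ‖(x : H →L[ℂ] H)‖ ≤ n}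

/-- Each sort carries the metric `d(x, y) = ‖x - y‖₂`. -/
noncomputable instance (n : ℕ) : MetricSpace (M.Ball n) :=
  MetricSpace.induced (fun x => M.toL2Pre x.1)
    (fun _ _ h => Subtype.ext (M.toL2Pre.injective h)) inferInstance

theorem dist_ball {n : ℕ} (x y : M.Ball n) : dist x y = M.norm2 (x.1 - y.1) := by
  rw [norm2, map_sub, ← dist_eq_norm]
  rfl

/-- Terms, with parameters from `A`, of the signature of tracial von Neumann algebras. `M.Term A Γ n`
is the type of terms with value in the sort of radius `n` whose free variables are listed, with the
radii of their sorts, by the context `Γ`. -/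
inductive Term (A : Set M.toStarSubalgebra) (Γ : List ℕ) : ℕ → Type _
  | var (i : Fin Γ.length) : Term A Γ (Γ.get i)
  | param (n : ℕ) (a : M.toStarSubalgebra) (ha : a ∈ A) (hn : ‖(a : H →L[ℂ] H)‖ ≤ n) : Term A Γ n
  | zero (n : ℕ) : Term A Γ n
  | one (n : ℕ) (hn : 1 ≤ n) : Term A Γ n
  | incl {m n : ℕ} (h : m ≤ n) (t : Term A Γ m) : Term A Γ n
  | add {m n : ℕ} (s : Term A Γ m) (t : Term A Γ n) : Term A Γ (m + n)
  | mul {m n : ℕ} (s : Term A Γ m) (t : Term A Γ n) : Term A Γ (m * n)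
  | smul {m n : ℕ} (c : ℂ) (h : ‖c‖ * m ≤ n) (t : Term A Γ m) : Term A Γ n
  | star {n : ℕ} (t : Term A Γ n) : Term A Γ n

/-- Formulas with parameters from `A`. The atomic formulas are the real and imaginary part of the
trace and the distance; the connectives are all continuous functions `ℝᵏ → ℝ`; the quantifiers bind
the first variable of the context. -/
inductive Formula (A : Set M.toStarSubalgebra) : List ℕ → Type _
  | trRe {Γ : List ℕ} {n : ℕ} (t : Term M A Γ n) : Formula A Γ
  | trIm {Γ : List ℕ} {n : ℕ} (t : Term M A Γ n) : Formula A Γ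
  | dist {Γ : List ℕ} {n : ℕ} (s t : Term M A Γ n) : Formula A Γ
  | conn {Γ : List ℕ} {k : ℕ} (u : (Fin k → ℝ) → ℝ) (hu : Continuous u)
      (φ : Fin k → Formula A Γ) : Formula A Γ
  | sup {Γ : List ℕ} (n : ℕ) (φ : Formula A (n :: Γ)) : Formula A Γ
  | inf {Γ : List ℕ} (n : ℕ) (φ : Formula A (n :: Γ)) : Formula A Γ

variable {M} {A : Set M.toStarSubalgebra}

/-- An assignment of values to the variables of `Γ`. -/
abbrev Assignment (M : TracialVNA H) (Γ : List ℕ) : Type _ := ∀ i : Fin Γ.length, M.Ball (Γ.get i)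

/-- Add a value for a new first variable to an assignment. -/
def Assignment.cons {Γ : List ℕ} {n : ℕ} (x : M.Ball n) (v : Assignment M Γ) :
    Assignment M (n :: Γ) :=
  Fin.cons (α := fun i : Fin (n :: Γ).length => M.Ball ((n :: Γ).get i)) x v

/-- The value of a term. -/
noncomputable def Term.eval {Γ : List ℕ} (v : Assignment M Γ) : {n : ℕ} → Term M A Γ n → M.Ball n
  | _, .var i => v i
  | _, .param _ a _ hn => ⟨a, hn⟩
  | _, .zero n => ⟨0, by simp⟩
  | _, .one n hn => ⟨1, by
      have h1 : ‖(1 : H →L[ℂ] H)‖ ≤ 1 := ContinuousLinearMap.norm_id_le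
      have h2 : (1 : ℝ) ≤ n := by exact_mod_cast hn
      exact h1.trans h2⟩
  | _, .incl h t => ⟨(t.eval v).1, (t.eval v).2.trans (by exact_mod_cast h)⟩
  | _, .add s t => ⟨(s.eval v).1 + (t.eval v).1, by
      have h := norm_add_le_of_le (s.eval v).2 (t.eval v).2
      exact_mod_cast h⟩
  | _, .mul s t => ⟨(s.eval v).1 * (t.eval v).1, by
      have h := norm_mul_le_of_le (s.eval v).2 (t.eval v).2
      exact_mod_cast h⟩
  | _, .smul c h t => ⟨c • (t.eval v).1, by
      have h' : ‖c • ((t.eval v).1 : H →L[ℂ] H)‖ ≤ _ := (norm_smul_le c _).trans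
        ((mul_le_mul_of_nonneg_left (t.eval v).2 (norm_nonneg c)).trans h)
      exact h'⟩
  | _, .star t => ⟨Star.star (t.eval v).1, by
      have h : ‖Star.star ((t.eval v).1 : H →L[ℂ] H)‖ ≤ _ := (norm_star _).le.trans (t.eval v).2
      exact h⟩

/-- The interpretation of a formula. -/
noncomputable def Formula.interp : {Γ : List ℕ} → Formula M A Γ → Assignment M Γ → ℝ
  | _, .trRe t, v => (M.tr (t.eval v).1).re
  | _, .trIm t, v => (M.tr (t.eval v).1).im
  | _, .dist s t, v => Dist.dist (s.eval v) (t.eval v)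
  | _, .conn u _ φ, v => u (fun i => (φ i).interp v)
  | _, .sup n φ, v => ⨆ x : M.Ball n, φ.interp (Assignment.cons x v)
  | _, .inf n φ, v => ⨅ x : M.Ball n, φ.interp (Assignment.cons x v)

/-- The assignment to one variable in the sort of the operator norm unit ball. -/
def Assignment.single (x : M.Ball 1) : Assignment M [1] :=
  Assignment.cons x (fun i => i.elim0)

/-! ### Definability in `M` -/

/-- `f : M₁ → ℝ` is the interpretation of a formula in `M` over `A`, that is, the limit of a
uniformly Cauchy sequence of (interpretations of) formulas with parameters from `A`. -/
def IsFormulaOver (A : Set M.toStarSubalgebra) (f : M.Ball 1 → ℝ) : Prop :=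
  ∃ φ : ℕ → Formula M A [1],
    TendstoUniformly (fun n x => (φ n).interp (Assignment.single x)) f atTop

/-- A closed set `X ⊆ M₁` is definable in `M` over `A` if `x ↦ d(x, X)` is the interpretation of a
formula in `M` over `A`. -/
def IsDefinableOver (A : Set M.toStarSubalgebra) (X : Set (M.Ball 1)) : Prop :=
  IsClosed X ∧ IsFormulaOver A (fun x => Metric.infDist x X)

variable (M)

/-- `Q ⊆ M` is a definable subalgebra of `M` (over `A`): it is a subalgebra of `M` whose
operator norm unit ball `Q ∩ M₁` is a definable subset of `M₁`. -/
def IsDefinableSubalgebra (A : Set M.toStarSubalgebra) (Q : VonNeumannAlgebra H) : Prop :=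
  Q ≤ M.toVonNeumannAlgebra ∧ IsDefinableOver A {x : M.Ball 1 | (x.1 : H →L[ℂ] H) ∈ Q}

/-- `N` has w-spectral gap in `M`: for every `ε > 0` there are finitely many unitaries `u ∈ N` and
`δ > 0` such that for all `x ∈ M₁`, if `‖[x, u]‖₂ ≤ δ` for all these `u`, then
`‖x - 𝔼_{N' ∩ M}(x)‖₂ ≤ ε`. -/
def HasWSpectralGap (N : VonNeumannAlgebra H) : Prop :=
  ∀ ε : ℝ, 0 < ε → ∃ F : Finset M.toStarSubalgebra,
    (∀ u ∈ F, u ∈ unitary M.toStarSubalgebra ∧ (u : H →L[ℂ] H) ∈ N) ∧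
    ∃ δ : ℝ, 0 < δ ∧ ∀ x : M.Ball 1, (∀ u ∈ F, M.norm2 (x.1 * u - u * x.1) ≤ δ) →
      ‖M.toL2 x.1 - M.condExp (relCommutant N M.toVonNeumannAlgebra) (M.toL2 x.1)‖ ≤ ε

end TracialVNA

/-! Let `X` be the unit ball of `N' ∩ M`. For `x ∈ M₁`, the element `y` of minimal 2-norm in the
2-norm closed convex hull of the conjugates `u x u*`, with `u` a unitary of `N`, is fixed by these
conjugations. So `y` lies in `X`, it is the conditional expectation of `x`, and `‖x - y‖₂ ≤ sup_u
‖[x, u]‖₂` (`exists_mem_relCommutant`). The hull stays inside `M₁` because `M₁` is complete for the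
2-norm.

By `isFormulaOver_infDist`, `X` is definable once, for each `ε`, some formula `f` is nonpositive on
`X` and satisfies `d(·, X) ≤ f + ε`. If `N` is definable, `f(x) = sup_{z ∈ M₁} (‖[x, z]‖₂ - 4 d(z, N
∩ M₁))` works for every `ε`: the penalty term replaces quantification over `N ∩ M₁`. If `N` has
w-spectral gap, a multiple of a finite sum of terms `‖[x, u]‖₂` works, with the unitaries `u ∈ N` as
parameters. Hence `N' ∩ M` is definable over `N`, and the first case applied to `N' ∩ M` gives the
second claim. -/

namespace TracialVNA

variable {H : Type*} [NormedAddCommGroup H] [InnerProductSpace ℂ H] [CompleteSpace H]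
  {M : TracialVNA H} {A : Set M.toStarSubalgebra}

/-! ### Substitution of terms for variables -/

/-- Substitute terms for the variables of a term. -/
def Term.subst {Γ Δ : List ℕ} (σ : ∀ i : Fin Γ.length, Term M A Δ (Γ.get i)) :
    {n : ℕ} → Term M A Γ n → Term M A Δ n
  | _, .var i => σ i
  | _, .param n a ha hn => .param n a ha hn
  | _, .zero n => .zero n
  | _, .one n hn => .one n hn
  | _, .incl h t => .incl h (t.subst σ)
  | _, .add s t => .add (s.subst σ) (t.subst σ)
  | _, .mul s t => .mul (s.subst σ) (t.subst σ)
  | _, .smul c h t => .smul c h (t.subst σ)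
  | _, .star t => .star (t.subst σ)

theorem Term.eval_subst {Γ Δ : List ℕ} (σ : ∀ i : Fin Γ.length, Term M A Δ (Γ.get i))
    (v : Assignment M Δ) {n : ℕ} (t : Term M A Γ n) :
    (t.subst σ).eval v = t.eval (fun i => (σ i).eval v) := by
  induction t with
  | var i => rfl
  | param => rfl
  | zero => rfl
  | one => rfl
  | incl h t ih => simp only [subst, eval, ih]; rfl
  | add s t ihs iht => simp only [subst, eval, ihs, iht]; rfl
  | mul s t ihs iht => simp only [subst, eval, ihs, iht]; rfl
  | smul c h t ih => simp only [subst, eval, ih]; rfl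
  | star t ih => simp only [subst, eval, ih]; rfl

/-- A term, in a context with a new first variable. -/
def Term.weaken {Γ : List ℕ} {n : ℕ} (m : ℕ) (t : Term M A Γ n) : Term M A (m :: Γ) n :=
  t.subst (fun i => .var (Γ := m :: Γ) i.succ)

theorem Term.eval_weaken {Γ : List ℕ} {n m : ℕ} (t : Term M A Γ n) (x : M.Ball m)
    (v : Assignment M Γ) : (t.weaken m).eval (Assignment.cons x v) = t.eval v :=
  t.eval_subst _ _

/-- The substitution `σ` under a quantifier. -/
def liftSubst {Γ Δ : List ℕ} (m : ℕ) (σ : ∀ i : Fin Γ.length, Term M A Δ (Γ.get i)) :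
    ∀ i : Fin (m :: Γ).length, Term M A (m :: Δ) ((m :: Γ).get i) :=
  Fin.cons (α := fun i : Fin (m :: Γ).length => Term M A (m :: Δ) ((m :: Γ).get i))
    (.var (Γ := m :: Δ) (0 : Fin (Δ.length + 1))) (fun i => (σ i).weaken m)

theorem eval_liftSubst {Γ Δ : List ℕ} {m : ℕ}
    (σ : ∀ i : Fin Γ.length, Term M A Δ (Γ.get i)) (x : M.Ball m) (v : Assignment M Δ) :
    (fun i => (liftSubst m σ i).eval (Assignment.cons x v))
      = Assignment.cons x (fun i => (σ i).eval v) := by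
  funext i
  refine Fin.cases ?_ (fun i => ?_) i
  · rfl
  · exact (σ i).eval_weaken x v

/-- Substitute terms for the free variables of a formula. -/
def Formula.subst : {Γ Δ : List ℕ} → (∀ i : Fin Γ.length, Term M A Δ (Γ.get i)) →
    Formula M A Γ → Formula M A Δ
  | _, _, σ, .trRe t => .trRe (t.subst σ)
  | _, _, σ, .trIm t => .trIm (t.subst σ)
  | _, _, σ, .dist s t => .dist (s.subst σ) (t.subst σ)
  | _, _, σ, .conn u hu φ => .conn u hu (fun i => (φ i).subst σ)
  | _, _, σ, .sup n φ => .sup n (φ.subst (liftSubst n σ))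
  | _, _, σ, .inf n φ => .inf n (φ.subst (liftSubst n σ))

theorem Formula.interp_subst {Γ : List ℕ} (φ : Formula M A Γ) : ∀ {Δ : List ℕ}
    (σ : ∀ i : Fin Γ.length, Term M A Δ (Γ.get i)) (v : Assignment M Δ),
    (φ.subst σ).interp v = φ.interp (fun i => (σ i).eval v) := by
  induction φ with
  | trRe t => intro Δ σ v; simp only [subst, interp, Term.eval_subst]
  | trIm t => intro Δ σ v; simp only [subst, interp, Term.eval_subst]
  | dist s t => intro Δ σ v; simp only [subst, interp, Term.eval_subst]
  | conn u hu φ ih => intro Δ σ v; simp only [subst, interp, ih]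
  | sup n φ ih => intro Δ σ v; simp only [subst, interp, ih, eval_liftSubst]
  | inf n φ ih => intro Δ σ v; simp only [subst, interp, ih, eval_liftSubst]

/-! ### Uniform limits of formulas in several variables -/

/-- A function of assignments to `Γ` that is a uniform limit of formulas over `A`. -/
def IsFormulaIn (A : Set M.toStarSubalgebra) (Γ : List ℕ) (f : Assignment M Γ → ℝ) : Prop :=
  ∀ ε : ℝ, 0 < ε → ∃ φ : Formula M A Γ, ∀ v, |φ.interp v - f v| ≤ ε

theorem Assignment.single_surjective :
    Function.Surjective (Assignment.single : M.Ball 1 → Assignment M [1]) := by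
  intro v
  refine ⟨v (0 : Fin 1), funext fun i => ?_⟩
  obtain rfl : i = (0 : Fin 1) := Subsingleton.elim (α := Fin 1) _ _
  rfl

/-- The `ε` form makes sense in every context, which is needed to treat quantifiers; approximants
within `1 / (n + 1)` recover a uniformly convergent sequence. -/
theorem isFormulaOver_iff {f : M.Ball 1 → ℝ} :
    IsFormulaOver A f ↔ IsFormulaIn A [1] (fun v => f (v (0 : Fin 1))) := by
  constructor
  · rintro ⟨φ, hφ⟩ ε hε
    obtain ⟨n, hn⟩ := (Metric.tendstoUniformly_iff.1 hφ ε hε).exists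
    refine ⟨φ n, fun v => ?_⟩
    obtain ⟨x, rfl⟩ := Assignment.single_surjective v
    rw [abs_sub_comm]
    exact (hn x).le
  · intro h
    choose φ hφ using fun n : ℕ => h (1 / (n + 1)) Nat.one_div_pos_of_nat
    refine ⟨φ, Metric.tendstoUniformly_iff.2 fun ε hε => ?_⟩
    filter_upwards [tendsto_one_div_add_atTop_nhds_zero_nat.eventually (gt_mem_nhds hε)]
      with n hn x
    rw [dist_comm]
    exact (hφ n _).trans_lt hn

theorem IsFormulaIn.of_formula {Γ : List ℕ} (φ : Formula M A Γ) : IsFormulaIn A Γ φ.interp :=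
  fun ε hε => ⟨φ, fun v => by simpa using hε.le⟩

theorem IsFormulaIn.of_approx {Γ : List ℕ} {f : Assignment M Γ → ℝ}
    (h : ∀ ε : ℝ, 0 < ε → ∃ g, IsFormulaIn A Γ g ∧ ∀ v, |g v - f v| ≤ ε) :
    IsFormulaIn A Γ f := by
  intro ε hε
  obtain ⟨g, hg, hgf⟩ := h (ε / 2) (half_pos hε)
  obtain ⟨φ, hφ⟩ := hg (ε / 2) (half_pos hε)
  refine ⟨φ, fun v => ?_⟩
  have := abs_sub_le (φ.interp v) (g v) (f v)
  linarith [hφ v, hgf v]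

/-- This allows a formula in one variable to be read in a context with a further variable, before
one of them is quantified. -/
theorem IsFormulaIn.subst {Γ Δ : List ℕ} {f : Assignment M Γ → ℝ} (hf : IsFormulaIn A Γ f)
    (σ : ∀ i : Fin Γ.length, Term M A Δ (Γ.get i)) :
    IsFormulaIn A Δ (fun v => f (fun i => (σ i).eval v)) := by
  intro ε hε
  obtain ⟨φ, hφ⟩ := hf ε hε
  exact ⟨φ.subst σ, fun v => by rw [φ.interp_subst]; exact hφ _⟩

theorem IsFormulaIn.const_mul {Γ : List ℕ} {f : Assignment M Γ → ℝ} (hf : IsFormulaIn A Γ f)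
    (c : ℝ) : IsFormulaIn A Γ (fun v => c * f v) := by
  intro ε hε
  obtain ⟨φ, hφ⟩ := hf (ε / (|c| + 1)) (by positivity)
  refine ⟨.conn (k := 1) (fun x => c * x 0) (by fun_prop) (fun _ => φ), fun v => ?_⟩
  have h := hφ v
  rw [le_div_iff₀ (by positivity)] at h
  simp only [Formula.interp]
  rw [← mul_sub, abs_mul]
  nlinarith [abs_nonneg (φ.interp v - f v)]

theorem IsFormulaIn.add {Γ : List ℕ} {f g : Assignment M Γ → ℝ} (hf : IsFormulaIn A Γ f)
    (hg : IsFormulaIn A Γ g) : IsFormulaIn A Γ (fun v => f v + g v) := by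
  intro ε hε
  obtain ⟨φ, hφ⟩ := hf (ε / 2) (half_pos hε)
  obtain ⟨ψ, hψ⟩ := hg (ε / 2) (half_pos hε)
  refine ⟨.conn (k := 2) (fun x => x 0 + x 1) (by fun_prop) ![φ, ψ], fun v => ?_⟩
  simp only [Formula.interp, Matrix.cons_val_zero, Matrix.cons_val_one]
  have h1 := abs_le.1 (hφ v)
  have h2 := abs_le.1 (hψ v)
  rw [abs_le]
  constructor <;> linarith

theorem IsFormulaIn.zero {Γ : List ℕ} : IsFormulaIn A Γ (fun _ => (0 : ℝ)) :=
  .of_formula (.conn (k := 0) (fun _ => 0) continuous_const (fun i => i.elim0))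

theorem IsFormulaIn.sum {Γ : List ℕ} {ι : Type*} (s : Finset ι) {f : ι → Assignment M Γ → ℝ}
    (hf : ∀ i ∈ s, IsFormulaIn A Γ (f i)) : IsFormulaIn A Γ (fun v => ∑ i ∈ s, f i v) := by
  classical
  induction s using Finset.induction_on with
  | empty => simpa using IsFormulaIn.zero
  | insert a s ha ih =>
    simp only [Finset.sum_insert ha]
    exact (hf a (Finset.mem_insert_self _ _)).add
      (ih fun i hi => hf i (Finset.mem_insert_of_mem hi))

noncomputable instance (n : ℕ) : Inhabited (M.Ball n) := ⟨⟨0, by simp⟩⟩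

/-- Boundedness has to be assumed because an unbounded real supremum takes the default value 0. A
bound for `g` alone suffices, since `f ≤ g + ε`. -/
theorem abs_iSup_sub_iSup_le {ι : Type*} [Nonempty ι] {f g : ι → ℝ} {ε : ℝ}
    (hg : BddAbove (Set.range g)) (h : ∀ i, |f i - g i| ≤ ε) :
    |(⨆ i, f i) - ⨆ i, g i| ≤ ε := by
  have h1 : ∀ i, f i ≤ (⨆ i, g i) + ε := fun i => by
    linarith [le_ciSup hg i, (abs_le.1 (h i)).2]
  have h2 : (⨆ i, g i) ≤ (⨆ i, f i) + ε := ciSup_le fun i => by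
    linarith [le_ciSup ⟨_, Set.forall_mem_range.2 h1⟩ i, (abs_le.1 (h i)).1]
  rw [abs_le]
  constructor <;> linarith [ciSup_le h1]

theorem abs_iInf_sub_iInf_le {ι : Type*} [Nonempty ι] {f g : ι → ℝ} {ε : ℝ}
    (hg : BddBelow (Set.range g)) (h : ∀ i, |f i - g i| ≤ ε) :
    |(⨅ i, f i) - ⨅ i, g i| ≤ ε := by
  have h1 : ∀ i, (⨅ i, g i) - ε ≤ f i := fun i => by
    linarith [ciInf_le hg i, (abs_le.1 (h i)).1]
  have h2 : (⨅ i, f i) - ε ≤ ⨅ i, g i := le_ciInf fun i => by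
    linarith [ciInf_le ⟨_, Set.forall_mem_range.2 h1⟩ i, (abs_le.1 (h i)).2]
  rw [abs_le]
  constructor <;> linarith [le_ciInf h1]

theorem IsFormulaIn.iSup {Γ : List ℕ} {n : ℕ} {f : Assignment M (n :: Γ) → ℝ}
    (hf : IsFormulaIn A (n :: Γ) f)
    (hb : ∀ v, BddAbove (Set.range fun x : M.Ball n => f (Assignment.cons x v))) :
    IsFormulaIn A Γ (fun v => ⨆ x : M.Ball n, f (Assignment.cons x v)) := by
  intro ε hε
  obtain ⟨φ, hφ⟩ := hf ε hε
  exact ⟨.sup n φ, fun v => abs_iSup_sub_iSup_le (hb v) fun x => hφ _⟩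

theorem IsFormulaIn.iInf {Γ : List ℕ} {n : ℕ} {f : Assignment M (n :: Γ) → ℝ}
    (hf : IsFormulaIn A (n :: Γ) f)
    (hb : ∀ v, BddBelow (Set.range fun x : M.Ball n => f (Assignment.cons x v))) :
    IsFormulaIn A Γ (fun v => ⨅ x : M.Ball n, f (Assignment.cons x v)) := by
  intro ε hε
  obtain ⟨φ, hφ⟩ := hf ε hε
  exact ⟨.inf n φ, fun v => abs_iInf_sub_iInf_le (hb v) fun x => hφ _⟩

end TracialVNA

/-- The unit ball of `B(H)` is compact in the weak operator topology. -/
theorem exists_tendsto_wot_of_norm_le_one {H : Type*} [NormedAddCommGroup H]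
    [InnerProductSpace ℂ H] [CompleteSpace H] {ι : Type*} (l : Ultrafilter ι) (f : ι → H →L[ℂ] H)
    (hf : ∀ i, ‖f i‖ ≤ 1) :
    ∃ T : H →L[ℂ] H, ‖T‖ ≤ 1 ∧
      Tendsto (fun i => (ContinuousLinearMapWOT.ofCLM (f i) : H →WOT[ℂ] H)) l
        (nhds (ContinuousLinearMapWOT.ofCLM T)) := by
  have hb : ∀ i (ξ η : H), ‖inner ℂ (f i ξ) η‖ ≤ ‖ξ‖ * ‖η‖ := fun i ξ η =>
    (norm_inner_le_norm _ _).trans (mul_le_mul_of_nonneg_right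
      (((f i).le_opNorm ξ).trans (mul_le_of_le_one_left (norm_nonneg _) (hf i))) (norm_nonneg _))
  -- Each matrix coefficient stays in a compact disc, so it converges along the ultrafilter. The
  -- limits form a bounded sesquilinear form, which is represented by an operator.
  have hlim : ∀ ξ η : H, ∃ c : ℂ, ‖c‖ ≤ ‖ξ‖ * ‖η‖ ∧
      Tendsto (fun i => inner ℂ (f i ξ) η) l (nhds c) := by
    intro ξ η
    obtain ⟨c, hc, hl⟩ := (isCompact_closedBall (0 : ℂ) (‖ξ‖ * ‖η‖)).ultrafilter_le_nhds
      (l.map fun i => inner ℂ (f i ξ) η) (by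
        rw [Ultrafilter.coe_map, le_principal_iff, mem_map]
        exact Eventually.of_forall fun i => by simpa using hb i ξ η)
    exact ⟨c, by simpa using hc, hl⟩
  choose B hB hlim using hlim
  let B₂ : H →ₗ⋆[ℂ] H →ₗ[ℂ] ℂ := LinearMap.mk₂'ₛₗ (starRingEnd ℂ) (RingHom.id ℂ) B
    (fun a b c => tendsto_nhds_unique (hlim _ _)
      (((hlim a c).add (hlim b c)).congr fun i => by rw [map_add, inner_add_left]))
    (fun r a c => tendsto_nhds_unique (hlim _ _)
      (((hlim a c).const_mul _).congr fun i => by rw [map_smul, inner_smul_left]))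
    (fun a b c => tendsto_nhds_unique (hlim _ _)
      (((hlim a b).add (hlim a c)).congr fun i => by rw [inner_add_right]))
    (fun r a c => tendsto_nhds_unique (hlim _ _)
      (((hlim a c).const_mul _).congr fun i => by rw [inner_smul_right]; rfl))
  let B₃ : H →L⋆[ℂ] H →L[ℂ] ℂ := B₂.mkContinuous₂ 1 (fun a b => by
    rw [one_mul]; exact hB a b)
  let T := InnerProductSpace.continuousLinearMapOfBilin B₃
  have hT : ∀ ξ η, inner ℂ (T ξ) η = B ξ η :=
    fun ξ η => InnerProductSpace.continuousLinearMapOfBilin_apply B₃ ξ η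
  refine ⟨T, T.opNorm_le_bound zero_le_one fun ξ => ?_, ?_⟩
  -- Testing the bound at `η = T ξ` gives `‖T ξ‖² ≤ ‖ξ‖ ‖T ξ‖`.
  · have h := hB ξ (T ξ)
    rw [← hT, inner_self_eq_norm_sq_to_K] at h
    rcases (norm_nonneg (T ξ)).eq_or_lt with h0 | h0
    · rw [← h0]; positivity
    · have h' : ‖T ξ‖ * ‖T ξ‖ ≤ ‖ξ‖ * ‖T ξ‖ := by simpa [sq] using h
      rw [one_mul]
      exact le_of_mul_le_mul_right h' h0
  · rw [ContinuousLinearMapWOT.tendsto_iff_forall_inner_apply_tendsto]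
    intro ξ η
    have h := (Complex.continuous_conj.tendsto _).comp (hlim ξ η)
    rw [← hT] at h
    simpa [Function.comp_def] using h

namespace TracialVNA

variable {H : Type*} [NormedAddCommGroup H] [InnerProductSpace ℂ H] [CompleteSpace H]
  (M : TracialVNA H)

/-! ### Inequalities for the 2-norm. -/

theorem norm2_sq (x : M.toStarSubalgebra) : (M.norm2 x ^ 2 : ℝ) = (M.tr (star x * x)).re := by
  rw [norm2_eq, Real.sq_sqrt (Complex.le_def.1 (M.tr_nonneg x)).1]

theorem norm2_congr {x y : M.toStarSubalgebra} (h : M.tr (star x * x) = M.tr (star y * y)) :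
    M.norm2 x = M.norm2 y := by
  rw [norm2_eq, norm2_eq, h]

theorem norm2_unitary_mul {u : M.toStarSubalgebra} (hu : u ∈ unitary M.toStarSubalgebra)
    (x : M.toStarSubalgebra) : M.norm2 (u * x) = M.norm2 x := by
  apply M.norm2_congr
  rw [star_mul, mul_assoc, ← mul_assoc (star u), Unitary.star_mul_self_of_mem hu, one_mul]

theorem norm2_mul_unitary {u : M.toStarSubalgebra} (hu : u ∈ unitary M.toStarSubalgebra)
    (x : M.toStarSubalgebra) : M.norm2 (x * u) = M.norm2 x := by
  apply M.norm2_congr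
  rw [M.tr_comm, star_mul, mul_assoc, ← mul_assoc u, Unitary.mul_star_self_of_mem hu, one_mul,
    M.tr_comm]

theorem norm2_nonneg (x : M.toStarSubalgebra) : 0 ≤ M.norm2 x := norm_nonneg _

theorem norm2_sub_le (x y : M.toStarSubalgebra) : M.norm2 (x - y) ≤ M.norm2 x + M.norm2 y := by
  rw [norm2, map_sub]
  exact norm_sub_le _ _

theorem norm2_eq_zero {x : M.toStarSubalgebra} : M.norm2 x = 0 ↔ x = 0 := by
  rw [norm2, norm_eq_zero, LinearEquiv.map_eq_zero_iff]

theorem norm2_smul (c : ℂ) (x : M.toStarSubalgebra) : M.norm2 (c • x) = ‖c‖ * M.norm2 x := by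
  rw [norm2, map_smul, norm_smul]
  rfl

theorem _root_.VonNeumannAlgebra.isClosed (N : VonNeumannAlgebra H) :
    IsClosed (N.toStarSubalgebra : Set (H →L[ℂ] H)) := by
  have h : (N.toStarSubalgebra : Set (H →L[ℂ] H))
      = Set.centralizer (Set.centralizer (N : Set (H →L[ℂ] H))) := by
    rw [N.centralizer_centralizer]; rfl
  rw [h]
  exact Set.isClosed_centralizer _

theorem _root_.VonNeumannAlgebra.exists_sum_four_unitary (N : VonNeumannAlgebra H)
    (x : N.toStarSubalgebra) :
    ∃ u : Fin 4 → unitary N.toStarSubalgebra, ∃ c : Fin 4 → ℂ,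
      x = ∑ i, c i • (u i : N.toStarSubalgebra) ∧ ∀ i, ‖c i‖ ≤ ‖(x : H →L[ℂ] H)‖ / 2 := by
  have := N.isClosed
  exact CStarAlgebra.exists_sum_four_unitary x

theorem norm2_sum_le {ι : Type*} (s : Finset ι) (f : ι → M.toStarSubalgebra) :
    M.norm2 (∑ i ∈ s, f i) ≤ ∑ i ∈ s, M.norm2 (f i) := by
  rw [norm2, map_sum]
  exact norm_sum_le _ _

/-- Multiplication by a unitary preserves the 2-norm, and `x` is a combination of four unitaries
with coefficients at most `‖x‖ / 2`. The resulting constant 2 is not sharp; it is the source of the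
constants 4 and 8 below. -/
theorem norm2_mul_le (x y : M.toStarSubalgebra) :
    M.norm2 (x * y) ≤ 2 * ‖(x : H →L[ℂ] H)‖ * M.norm2 y := by
  obtain ⟨u, c, hx, hc⟩ := M.exists_sum_four_unitary x
  calc M.norm2 (x * y) = M.norm2 (∑ i, c i • ((u i : M.toStarSubalgebra) * y)) := by
        conv_lhs => rw [hx]
        rw [Finset.sum_mul]
        simp only [smul_mul_assoc]
    _ ≤ ∑ i, M.norm2 (c i • ((u i : M.toStarSubalgebra) * y)) := M.norm2_sum_le _ _
    _ ≤ ∑ i : Fin 4, ‖(x : H →L[ℂ] H)‖ / 2 * M.norm2 y := by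
        refine Finset.sum_le_sum fun i _ => ?_
        rw [norm2_smul, M.norm2_unitary_mul (u i).2]
        exact mul_le_mul_of_nonneg_right (hc i) (M.norm2_nonneg y)
    _ = 2 * ‖(x : H →L[ℂ] H)‖ * M.norm2 y := by simp; ring

theorem norm2_mul_le' (x y : M.toStarSubalgebra) :
    M.norm2 (y * x) ≤ 2 * ‖(x : H →L[ℂ] H)‖ * M.norm2 y := by
  have h : ∀ z, M.norm2 (star z) = M.norm2 z := fun z => by
    apply M.norm2_congr
    rw [star_star, M.tr_comm]
  rw [← h (y * x), star_mul, ← h y]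
  have := M.norm2_mul_le (star x) (star y)
  have e : ‖((star x : M.toStarSubalgebra) : H →L[ℂ] H)‖ = ‖(x : H →L[ℂ] H)‖ := norm_star _
  rwa [e] at this

theorem norm_ball_one (x : M.Ball 1) : ‖(x.1 : H →L[ℂ] H)‖ ≤ 1 := by
  simpa using x.2

theorem norm2_one : M.norm2 1 = 1 := by
  simp [norm2_eq, M.tr_one]

theorem norm2_ball_one_le (x : M.Ball 1) : M.norm2 x.1 ≤ 2 := by
  have := M.norm2_mul_le x.1 1
  rw [mul_one, norm2_one] at this
  linarith [M.norm_ball_one x]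

theorem norm2_commutator_le (x z : M.toStarSubalgebra) :
    M.norm2 (x * z - z * x) ≤ 4 * ‖(x : H →L[ℂ] H)‖ * M.norm2 z := by
  linarith [M.norm2_sub_le (x * z) (z * x), M.norm2_mul_le x z, M.norm2_mul_le' x z]

/-! ### Completeness of the unit ball -/

/-- Left multiplication by `a` is continuous for the weak operator topology. Normality speaks only
of the unit ball, so `a` is first scaled by `(‖a‖ + 1)⁻¹`. -/
theorem tendsto_tr_mul {ι : Type*} {l : Filter ι} {f : ι → M.Ball 1} {y : M.Ball 1}
    (h : Tendsto (fun i => (ContinuousLinearMapWOT.ofCLM ((f i).1 : H →L[ℂ] H) : H →WOT[ℂ] H)) l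
      (nhds (ContinuousLinearMapWOT.ofCLM (y.1 : H →L[ℂ] H)))) (a : M.toStarSubalgebra) :
    Tendsto (fun i => M.tr (a * (f i).1)) l (nhds (M.tr (a * y.1))) := by
  set r : ℝ := ‖(a : H →L[ℂ] H)‖ + 1 with hr
  have hr0 : 0 < r := by positivity
  have hball : ∀ x : M.Ball 1,
      ‖((((r : ℂ)⁻¹ • (a * x.1) : M.toStarSubalgebra)) : H →L[ℂ] H)‖ ≤ 1 := by
    intro x
    have h1 : ‖(a : H →L[ℂ] H) * (x.1 : H →L[ℂ] H)‖ ≤ r :=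
      (norm_mul_le _ _).trans (by nlinarith [M.norm_ball_one x, norm_nonneg (a : H →L[ℂ] H)])
    have h2 : ‖(r : ℂ)⁻¹ • ((a : H →L[ℂ] H) * (x.1 : H →L[ℂ] H))‖ ≤ 1 := by
      rw [norm_smul, norm_inv, Complex.norm_real, Real.norm_of_nonneg hr0.le, inv_mul_le_iff₀ hr0]
      linarith
    exact h2
  let g : M.Ball 1 → {x : M.toStarSubalgebra // ‖(x : H →L[ℂ] H)‖ ≤ 1} := fun x => ⟨_, hball x⟩
  have hg : Tendsto (fun i => M.tr (g (f i)).1) l (nhds (M.tr (g y).1)) := by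
    let : TopologicalSpace {x : M.toStarSubalgebra // ‖(x : H →L[ℂ] H)‖ ≤ 1} :=
      TopologicalSpace.induced
        (fun x => (ContinuousLinearMapWOT.ofCLM (x.1 : H →L[ℂ] H) : H →WOT[ℂ] H)) inferInstance
    refine (M.tr_normal.tendsto (g y)).comp (f := fun i => g (f i)) ?_
    rw [nhds_induced, tendsto_comap_iff]
    have h1 := ((ContinuousLinearMapWOT.continuous_postcomp
      (ContinuousLinearMapWOT.ofCLM (a : H →L[ℂ] H) : H →WOT[ℂ] H)).tendsto _).comp h
    exact h1.const_smul ((r : ℂ)⁻¹)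
  have h2 := hg.const_mul (r : ℂ)
  have hrc : (r : ℂ) ≠ 0 := by exact_mod_cast hr0.ne'
  simpa [g, hrc] using h2

theorem mem_of_tendsto_wot {ι : Type*} {l : Filter ι} [NeBot l] {f : ι → H →L[ℂ] H}
    {T : H →L[ℂ] H} (N : VonNeumannAlgebra H) (hf : ∀ i, f i ∈ N)
    (h : Tendsto (fun i => (ContinuousLinearMapWOT.ofCLM (f i) : H →WOT[ℂ] H)) l
      (nhds (ContinuousLinearMapWOT.ofCLM T))) : T ∈ N := by
  rw [← N.commutant_commutant, VonNeumannAlgebra.mem_commutant_iff]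
  intro g hg
  have h1 := h.const_mul (ContinuousLinearMapWOT.ofCLM g)
  have h2 := h.mul_const (ContinuousLinearMapWOT.ofCLM g)
  apply ContinuousLinearMapWOT.ofCLM_injective
  refine tendsto_nhds_unique h1 (h2.congr fun i => ?_)
  have := VonNeumannAlgebra.mem_commutant_iff.1 hg (f i) (hf i)
  rw [← ContinuousLinearMapWOT.ofCLM_mul, ← ContinuousLinearMapWOT.ofCLM_mul, this]

theorem abs_tr_star_mul_le (a x : M.toStarSubalgebra) :
    ‖M.tr (star a * x)‖ ≤ M.norm2 a * M.norm2 x :=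
  norm_inner_le_norm (𝕜 := ℂ) (M.toL2Pre a) (M.toL2Pre x)

/-- A 2-norm Cauchy ultrafilter has a weak operator limit by compactness, and the limit is in `M` by
the double commutant theorem. It is also the 2-norm limit, by weak lower semicontinuity of the norm:
the Cauchy–Schwarz bounds on `tr (a* (x - z))` pass to the limit in `z`, and `a = x - y` is then
taken. -/
instance : CompleteSpace (M.Ball 1) := by
  refine completeSpace_iff_ultrafilter.2 fun l hl => ?_
  obtain ⟨T, hT1, hT⟩ := exists_tendsto_wot_of_norm_le_one l
    (fun x : M.Ball 1 => (x.1 : H →L[ℂ] H)) M.norm_ball_one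
  have hTM : T ∈ M.toVonNeumannAlgebra :=
    mem_of_tendsto_wot M.toVonNeumannAlgebra (fun x : M.Ball 1 => x.1.2) hT
  let y : M.Ball 1 := ⟨⟨T, hTM⟩, by simpa using hT1⟩
  refine ⟨y, ?_⟩
  rw [Metric.nhds_basis_closedBall.ge_iff]
  intro ε hε
  obtain ⟨s, hs, hsε⟩ := (Metric.cauchy_iff.1 hl).2 ε hε
  filter_upwards [hs] with x hx
  rw [Metric.mem_closedBall, dist_ball]
  have key : ∀ a : M.toStarSubalgebra, ‖M.tr (star a * (x.1 - y.1))‖ ≤ M.norm2 a * ε := by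
    intro a
    have h1 : Tendsto (fun z : M.Ball 1 => ‖M.tr (star a * (x.1 - z.1))‖) l
        (nhds ‖M.tr (star a * (x.1 - y.1))‖) := by
      simp only [mul_sub, map_sub]
      exact (tendsto_const_nhds.sub
        (M.tendsto_tr_mul (f := fun z => z) (y := y) hT (star a))).norm
    refine le_of_tendsto h1 ?_
    filter_upwards [hs] with z hz
    refine (M.abs_tr_star_mul_le _ _).trans (mul_le_mul_of_nonneg_left ?_ (M.norm2_nonneg a))
    rw [← dist_ball]
    exact (hsε x hx z hz).le
  have h := (Complex.re_le_norm _).trans (key (x.1 - y.1))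
  rw [← norm2_sq] at h
  rcases (M.norm2_nonneg (x.1 - y.1)).eq_or_lt with h0 | h0
  · rw [← h0]; exact hε.le
  · rw [sq] at h
    exact le_of_mul_le_mul_left h h0

end TracialVNA

/-- A complete convex set contains a point that is fixed by all norm preserving maps of the set to
itself: the point of minimal norm. -/
theorem exists_fixedPoint_of_complete_convex {E : Type*} [NormedAddCommGroup E]
    [InnerProductSpace ℂ E] {K : Set E} (hne : K.Nonempty) (hK : IsComplete K)
    (hc : Convex ℝ K) :
    ∃ a ∈ K, ∀ f : E → E, (∀ b, ‖f b‖ = ‖b‖) → (∀ b ∈ K, f b ∈ K) → f a = a := by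
  let := InnerProductSpace.complexToReal (G := E)
  obtain ⟨a, haK, ha⟩ := exists_norm_eq_iInf_of_complete_convex hne hK hc 0
  rw [norm_eq_iInf_iff_real_inner_le_zero hc haK] at ha
  -- Minimality gives `‖a‖² ≤ ⟪a, f a⟫`, with the real inner product. As `‖f a‖ = ‖a‖`, this forces
  -- `‖f a - a‖² ≤ 0`; linearity of `f` plays no role.
  refine ⟨a, haK, fun f hf hfK => ?_⟩
  have h := ha _ (hfK a haK)
  have h2 := norm_sub_sq_real (f a) a
  rw [hf] at h2
  rw [zero_sub, inner_neg_left, inner_sub_right, real_inner_self_eq_norm_sq,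
    real_inner_comm] at h
  rw [← sub_eq_zero, ← norm_eq_zero]
  nlinarith [norm_nonneg (f a - a)]

namespace TracialVNA

variable {H : Type*} [NormedAddCommGroup H] [InnerProductSpace ℂ H] [CompleteSpace H]
  (M : TracialVNA H)

/-! ### Averaging over the unitary group -/

theorem coe_mem_unitary {u : M.toStarSubalgebra} (hu : u ∈ unitary M.toStarSubalgebra) :
    (u : H →L[ℂ] H) ∈ unitary (H →L[ℂ] H) := by
  rw [Unitary.mem_iff] at hu ⊢
  exact ⟨congrArg Subtype.val hu.1, congrArg Subtype.val hu.2⟩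

theorem norm_unitary_le_one {u : M.toStarSubalgebra} (hu : u ∈ unitary M.toStarSubalgebra) :
    ‖(u : H →L[ℂ] H)‖ ≤ 1 := by
  rw [← mul_one (u : H →L[ℂ] H), CStarRing.norm_mem_unitary_mul _ (M.coe_mem_unitary hu)]
  exact ContinuousLinearMap.norm_id_le

/-- Conjugation by an element of `M`, on `M` with the `2`-norm. -/
noncomputable def conj (u : M.toStarSubalgebra) : M.L2Pre →ₗ[ℂ] M.L2Pre :=
  M.toL2Pre.toLinearMap ∘ₗ LinearMap.mulLeft ℂ u ∘ₗ LinearMap.mulRight ℂ (star u) ∘ₗ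
    M.toL2Pre.symm.toLinearMap

theorem conj_toL2Pre (u x : M.toStarSubalgebra) :
    M.conj u (M.toL2Pre x) = M.toL2Pre (u * (x * star u)) := rfl

theorem norm_conj {u : M.toStarSubalgebra} (hu : u ∈ unitary M.toStarSubalgebra) (a : M.L2Pre) :
    ‖M.conj u a‖ = ‖a‖ := by
  obtain ⟨x, rfl⟩ := M.toL2Pre.surjective a
  have h := (M.norm2_unitary_mul hu (x * star u)).trans
    (M.norm2_mul_unitary (Unitary.star_mem hu) x)
  exact h

theorem continuous_conj {u : M.toStarSubalgebra} (hu : u ∈ unitary M.toStarSubalgebra) :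
    Continuous (M.conj u) :=
  (AddMonoidHomClass.isometry_of_norm (M.conj u) (M.norm_conj hu)).continuous

theorem isComplete_range_ball :
    IsComplete (Set.range fun x : M.Ball 1 => M.toL2Pre x.1) :=
  (Isometry.of_dist_eq fun _ _ => rfl : Isometry fun x : M.Ball 1 => M.toL2Pre x.1
    ).isUniformInducing.isComplete_range

theorem convex_range_ball : Convex ℝ (Set.range fun x : M.Ball 1 => M.toL2Pre x.1) := by
  rintro _ ⟨x, rfl⟩ _ ⟨y, rfl⟩ s t hs ht hst
  have hb : ‖(s : ℂ) • (x.1 : H →L[ℂ] H) + (t : ℂ) • (y.1 : H →L[ℂ] H)‖ ≤ (1 : ℕ) := by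
    refine (norm_add_le _ _).trans ?_
    rw [norm_smul, norm_smul, Complex.norm_real, Complex.norm_real, Real.norm_of_nonneg hs,
      Real.norm_of_nonneg ht]
    have h1 := mul_le_of_le_one_right hs (M.norm_ball_one x)
    have h2 := mul_le_of_le_one_right ht (M.norm_ball_one y)
    push_cast
    linarith
  exact ⟨⟨(s : ℂ) • x.1 + (t : ℂ) • y.1, hb⟩, rfl⟩

/-- `N` is the linear span of its unitaries. -/
theorem mem_relCommutant_of_commute_unitary {N : VonNeumannAlgebra H}
    (hN : N ≤ M.toVonNeumannAlgebra) (y : M.toStarSubalgebra)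
    (h : ∀ u ∈ unitary M.toStarSubalgebra, (u : H →L[ℂ] H) ∈ N → u * y = y * u) :
    (y : H →L[ℂ] H) ∈ relCommutant N M.toVonNeumannAlgebra := by
  refine mem_relCommutant.2 ⟨fun n hn => ?_, y.2⟩
  obtain ⟨u, c, hu, -⟩ := N.exists_sum_four_unitary ⟨n, hn⟩
  have hn' : n = ∑ i, c i • ((u i : N.toStarSubalgebra) : H →L[ℂ] H) := by
    have := congrArg Subtype.val hu
    simpa using this
  rw [hn', Finset.sum_mul, Finset.mul_sum]
  refine Finset.sum_congr rfl fun i _ => ?_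
  have hi := Unitary.mem_iff.1 (u i).2
  have h1 : star ((u i : N.toStarSubalgebra) : H →L[ℂ] H) * (u i : N.toStarSubalgebra) = 1 :=
    congrArg Subtype.val hi.1
  have h2 : ((u i : N.toStarSubalgebra) : H →L[ℂ] H) * star (u i : N.toStarSubalgebra) = 1 :=
    congrArg Subtype.val hi.2
  have := congrArg Subtype.val (h ⟨(u i : N.toStarSubalgebra), hN (u i : N.toStarSubalgebra).2⟩
    (Unitary.mem_iff.2 ⟨Subtype.ext h1, Subtype.ext h2⟩) (u i : N.toStarSubalgebra).2)
  rw [smul_mul_assoc, mul_smul_comm]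
  exact congrArg (c i • ·) this

section ConjHull

/-- The closed convex hull, in the `2`-norm, of the conjugates of `x` by the unitaries of `N`. -/
def conjHull (N : VonNeumannAlgebra H) (x : M.Ball 1) : Set M.L2Pre :=
  closure (convexHull ℝ {a | ∃ u ∈ unitary M.toStarSubalgebra, (u : H →L[ℂ] H) ∈ N ∧
    M.conj u (M.toL2Pre x.1) = a})

variable {N : VonNeumannAlgebra H} (x : M.Ball 1)

theorem convex_conjHull : Convex ℝ (M.conjHull N x) := (convex_convexHull ℝ _).closure

theorem isClosed_conjHull : IsClosed (M.conjHull N x) := isClosed_closure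

theorem conj_mem_conjHull {u : M.toStarSubalgebra} (hu : u ∈ unitary M.toStarSubalgebra)
    (huN : (u : H →L[ℂ] H) ∈ N) : M.conj u (M.toL2Pre x.1) ∈ M.conjHull N x :=
  subset_closure (subset_convexHull ℝ _ ⟨u, hu, huN, rfl⟩)

theorem conjHull_nonempty : (M.conjHull N x).Nonempty :=
  ⟨_, M.conj_mem_conjHull x (one_mem _) (one_mem N)⟩

-- Every property of the hull below is obtained by checking it on the conjugates `u x u*` and
-- exhibiting it as a closed convex condition.
variable {M x} in
theorem conjHull_subset {P : Set M.L2Pre} (hP : IsClosed P) (hc : Convex ℝ P)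
    (h : ∀ u ∈ unitary M.toStarSubalgebra, (u : H →L[ℂ] H) ∈ N →
      M.conj u (M.toL2Pre x.1) ∈ P) : M.conjHull N x ⊆ P := by
  refine closure_minimal (convexHull_min ?_ hc) hP
  rintro _ ⟨u, hu, huN, rfl⟩
  exact h u hu huN

theorem conjHull_subset_range_ball :
    M.conjHull N x ⊆ Set.range fun x : M.Ball 1 => M.toL2Pre x.1 := by
  refine conjHull_subset M.isComplete_range_ball.isClosed M.convex_range_ball fun u hu _ => ?_
  have hb : ‖(u : H →L[ℂ] H) * ((x.1 : H →L[ℂ] H) * star (u : H →L[ℂ] H))‖ ≤ (1 : ℕ) := by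
    rw [CStarRing.norm_mem_unitary_mul _ (M.coe_mem_unitary hu),
      CStarRing.norm_mul_mem_unitary _ (Unitary.star_mem (M.coe_mem_unitary hu))]
    exact x.2
  exact ⟨⟨u * (x.1 * star u), hb⟩, rfl⟩

/-- `L2Pre` itself need not be complete; completeness comes from the image of the unit ball, which
contains the hull. -/
theorem isComplete_conjHull : IsComplete (M.conjHull N x) := fun f hf hfK => by
  obtain ⟨a, -, ha⟩ := M.isComplete_range_ball f hf
    (hfK.trans (principal_mono.2 (M.conjHull_subset_range_ball x)))
  have := hf.1
  exact ⟨a, (M.isClosed_conjHull x).mem_of_tendsto (f := id) ha (le_principal_iff.1 hfK), ha⟩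

variable {M x} in
theorem conj_mem_conjHull_of_mem {u : M.toStarSubalgebra} (hu : u ∈ unitary M.toStarSubalgebra)
    (huN : (u : H →L[ℂ] H) ∈ N) {a : M.L2Pre} (ha : a ∈ M.conjHull N x) :
    M.conj u a ∈ M.conjHull N x := by
  have h : M.conjHull N x ⊆ M.conj u ⁻¹' M.conjHull N x := by
    refine conjHull_subset ((M.isClosed_conjHull x).preimage (M.continuous_conj hu))
      ((M.convex_conjHull x).is_linear_preimage
        ⟨map_add _, fun c a => (M.conj u).map_smul_of_tower c a⟩) fun w hw hwN => ?_
    -- Conjugation by `u` permutes the generators of the hull, since the unitaries of `N` form a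
    -- group.
    have e : M.conj u (M.conj w (M.toL2Pre x.1)) = M.conj (u * w) (M.toL2Pre x.1) := by
      simp only [conj_toL2Pre, star_mul, mul_assoc]
    rw [Set.mem_preimage, e]
    exact M.conj_mem_conjHull x (mul_mem hu hw) (mul_mem huN hwN)
  exact h ha

/-- The element of minimal `2`-norm in the closed convex hull of the conjugates of `x` by the
unitaries of `N` is invariant under conjugation. -/
theorem exists_conj_eq_self :
    ∃ a ∈ M.conjHull N x, ∀ u ∈ unitary M.toStarSubalgebra, (u : H →L[ℂ] H) ∈ N →
      M.conj u a = a := by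
  obtain ⟨a, ha, hfix⟩ := exists_fixedPoint_of_complete_convex (M.conjHull_nonempty (N := N) x)
    (M.isComplete_conjHull x) (M.convex_conjHull x)
  exact ⟨a, ha, fun u hu huN => hfix _ (M.norm_conj hu) fun _ => conj_mem_conjHull_of_mem hu huN⟩

variable {M x}

/-- Right multiplication by `u*` is isometric, so `‖x - u x u*‖₂ = ‖[x, u]‖₂`, and balls are closed
and convex. -/
theorem norm2_sub_le_of_mem_conjHull {y : M.toStarSubalgebra}
    (hy : M.toL2Pre y ∈ M.conjHull N x) {r : ℝ}
    (hr : ∀ u ∈ unitary M.toStarSubalgebra, (u : H →L[ℂ] H) ∈ N →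
      M.norm2 (x.1 * u - u * x.1) ≤ r) : M.norm2 (x.1 - y) ≤ r := by
  have h : M.conjHull N x ⊆ Metric.closedBall (M.toL2Pre x.1) r := by
    refine conjHull_subset Metric.isClosed_closedBall (convex_closedBall _ _) fun u hu huN => ?_
    rw [Metric.mem_closedBall, dist_comm, dist_eq_norm, conj_toL2Pre, ← map_sub]
    refine le_trans (le_of_eq ?_) (hr u hu huN)
    rw [← M.norm2_mul_unitary (Unitary.star_mem hu) (x.1 * u - u * x.1), sub_mul, mul_assoc,
      Unitary.mul_star_self_of_mem hu, mul_one, mul_assoc]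
    rfl
  have := h hy
  rw [Metric.mem_closedBall, dist_comm, dist_eq_norm, ← map_sub] at this
  exact this

/-- Since `q` commutes with `u`, traciality gives `tr (q* u x u*) = tr (q* x)`, a closed affine
condition on the conjugate. -/
theorem tr_star_mul_of_mem_conjHull {y : M.toStarSubalgebra}
    (hy : M.toL2Pre y ∈ M.conjHull N x) {q : M.toStarSubalgebra}
    (hq : (q : H →L[ℂ] H) ∈ relCommutant N M.toVonNeumannAlgebra) :
    M.tr (star q * y) = M.tr (star q * x.1) := by
  have h : M.conjHull N x ⊆
      {a | inner ℂ (M.toL2Pre q) a = inner ℂ (M.toL2Pre q) (M.toL2Pre x.1)} := by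
    refine conjHull_subset (isClosed_eq (by fun_prop) continuous_const)
      ((convex_singleton (𝕜 := ℝ) (inner ℂ (M.toL2Pre q) (M.toL2Pre x.1))).linear_preimage
        ((innerₛₗ ℂ (M.toL2Pre q)).restrictScalars ℝ)) fun u hu huN => ?_
    have hc : star q * star u = star u * star q := by
      rw [← star_mul, ← star_mul]
      exact congrArg star (Subtype.ext ((mem_relCommutant.1 hq).1 u huN))
    change M.tr _ = M.tr _
    calc M.tr (star q * (u * (x.1 * star u))) = M.tr (star q * u * x.1 * star u) := by
          simp only [mul_assoc]
      _ = M.tr (star u * (star q * u * x.1)) := M.tr_comm _ _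
      _ = M.tr (star u * star q * u * x.1) := by simp only [mul_assoc]
      _ = M.tr (star q * x.1) := by
          rw [← hc, mul_assoc (star q), Unitary.star_mul_self_of_mem hu, mul_one]
  exact h hy

variable (M x)

/-- Every `x` in the unit ball of `M` has a conditional expectation on `N' ∩ M` in the unit ball,
at `2`-distance at most `sup ‖[x, u]‖₂` from `x`, over the unitaries `u` of `N`. -/
theorem exists_mem_relCommutant (hN : N ≤ M.toVonNeumannAlgebra) :
    ∃ y : M.Ball 1, (y.1 : H →L[ℂ] H) ∈ relCommutant N M.toVonNeumannAlgebra ∧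
      (∀ r : ℝ, (∀ u ∈ unitary M.toStarSubalgebra, (u : H →L[ℂ] H) ∈ N →
        M.norm2 (x.1 * u - u * x.1) ≤ r) → M.norm2 (x.1 - y.1) ≤ r) ∧
      ∀ q : M.toStarSubalgebra, (q : H →L[ℂ] H) ∈ relCommutant N M.toVonNeumannAlgebra →
        M.tr (star q * (x.1 - y.1)) = 0 := by
  obtain ⟨a, haK, hfix⟩ := M.exists_conj_eq_self (N := N) x
  obtain ⟨y, rfl⟩ := M.conjHull_subset_range_ball x haK
  refine ⟨y, M.mem_relCommutant_of_commute_unitary hN _ fun u hu huN => ?_,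
    fun r hr => norm2_sub_le_of_mem_conjHull haK hr, fun q hq => ?_⟩
  · have h : u * (y.1 * star u) = y.1 := M.toL2Pre.injective (hfix u hu huN)
    conv_rhs => rw [← h]
    rw [mul_assoc, mul_assoc, Unitary.star_mul_self_of_mem hu, mul_one]
  · rw [mul_sub, map_sub, sub_eq_zero, tr_star_mul_of_mem_conjHull haK hq]

end ConjHull

/-! ### Identification of the conditional expectation. -/

theorem norm_toL2 (x : M.toStarSubalgebra) : ‖M.toL2 x‖ = M.norm2 x :=
  UniformSpace.Completion.norm_coe (M.toL2Pre x)

theorem condExp_eq {Q : VonNeumannAlgebra H} {x y : M.toStarSubalgebra} (hy : (y : H →L[ℂ] H) ∈ Q)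
    (h : ∀ q : M.toStarSubalgebra, (q : H →L[ℂ] H) ∈ Q → M.tr (star q * (x - y)) = 0) :
    M.condExp Q (M.toL2 x) = M.toL2 y := by
  refine Submodule.eq_starProjection_of_mem_orthogonal
    (Submodule.le_topologicalClosure _ (Submodule.mem_map_of_mem hy)) ?_
  rw [L2Sub, Submodule.orthogonal_closure, Submodule.mem_orthogonal]
  rintro _ ⟨q, hq, rfl⟩
  rw [← map_sub]
  exact (UniformSpace.Completion.inner_coe (𝕜 := ℂ) _ _).trans (h q hq)

/-! ### Definability of relative commutants -/

/-- The operator norm unit ball of `Q`, as a subset of the operator norm unit ball of `M`. -/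
def unitBall (Q : VonNeumannAlgebra H) : Set (M.Ball 1) := {x | (x.1 : H →L[ℂ] H) ∈ Q}

theorem isClosed_unitBall_relCommutant {N : VonNeumannAlgebra H}
    (hN : N ≤ M.toVonNeumannAlgebra) :
    IsClosed (M.unitBall (relCommutant N M.toVonNeumannAlgebra)) := by
  have h : M.unitBall (relCommutant N M.toVonNeumannAlgebra)
      = ⋂ n : N, {x : M.Ball 1 | M.toL2Pre (⟨n, hN n.2⟩ * x.1 - x.1 * ⟨n, hN n.2⟩) = 0} := by
    ext x
    simp only [unitBall, Set.mem_ofPred_eq, mem_relCommutant, Set.mem_iInter,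
      LinearEquiv.map_eq_zero_iff, sub_eq_zero]
    exact ⟨fun h n => Subtype.ext (h.1 n n.2),
      fun h => ⟨fun n hn => congrArg Subtype.val (h ⟨n, hn⟩), x.1.2⟩⟩
  rw [h]
  refine isClosed_iInter fun n => isClosed_eq (LipschitzWith.of_dist_le_mul
    (K := ⟨4 * ‖(n : H →L[ℂ] H)‖, by positivity⟩) fun x y => ?_).continuous continuous_const
  rw [dist_eq_norm, ← map_sub, dist_ball]
  refine le_trans (le_of_eq ?_) (M.norm2_commutator_le ⟨n, hN n.2⟩ (x.1 - y.1))
  rw [norm2]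
  congr 2
  noncomm_ring

variable {M} {A : Set M.toStarSubalgebra}

/-- The function `x ↦ inf_y (f y + d(y, x))` is within `ε` of `d(x, Q)`: points `y ∈ Q` give the
upper bound, and `d(x, Q) ≤ d(y, Q) + d(y, x)` gives the lower one. -/
theorem isFormulaOver_infDist {Q : Set (M.Ball 1)} (hQ : Q.Nonempty)
    (h : ∀ ε : ℝ, 0 < ε → ∃ f : M.Ball 1 → ℝ, IsFormulaOver A f ∧ (∀ y ∈ Q, f y ≤ 0) ∧
      ∀ y, Metric.infDist y Q ≤ f y + ε) :
    IsFormulaOver A (fun x => Metric.infDist x Q) := by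
  rw [isFormulaOver_iff]
  refine IsFormulaIn.of_approx fun ε hε => ?_
  obtain ⟨f, hf, hf0, hfε⟩ := h ε hε
  have hlow : ∀ x y : M.Ball 1, Metric.infDist x Q - ε ≤ f y + dist y x := fun x y => by
    have := Metric.infDist_le_infDist_add_dist (s := Q) (x := x) (y := y)
    rw [dist_comm] at this
    linarith [hfε y]
  -- Quantifiers bind the first variable, so `v0` is the bound point `y` and `v1` is the free point
  -- `x`.
  let v0 : Term M A [1, 1] 1 := .var (Γ := [1, 1]) (0 : Fin 2)
  let v1 : Term M A [1, 1] 1 := .var (Γ := [1, 1]) (1 : Fin 2)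
  have h2 : IsFormulaIn A [1, 1]
      (fun v => f (v (0 : Fin 2)) + dist (v (0 : Fin 2)) (v (1 : Fin 2))) :=
    ((isFormulaOver_iff.1 hf).subst (Δ := [1, 1])
      (Fin.cons (α := fun i : Fin [1].length => Term M A [1, 1] ([1].get i)) v0
        fun i => i.elim0)).add (.of_formula (.dist v0 v1))
  have hbdd : ∀ x : M.Ball 1, BddBelow (Set.range fun y : M.Ball 1 => f y + dist y x) :=
    fun x => ⟨_, Set.forall_mem_range.2 (hlow x)⟩
  refine ⟨_, h2.iInf fun v => hbdd (v (0 : Fin 1)), fun v => ?_⟩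
  change |(⨅ y : M.Ball 1, (f y + dist y (v (0 : Fin 1)))) - Metric.infDist (v (0 : Fin 1)) Q| ≤ ε
  generalize v (0 : Fin 1) = x
  have h3 : (⨅ y : M.Ball 1, (f y + dist y x)) ≤ Metric.infDist x Q :=
    (Metric.le_infDist hQ).2 fun {y} hy => (ciInf_le (hbdd x) y).trans (by
      rw [dist_comm]; linarith [hf0 y hy])
  rw [abs_le]
  constructor <;> linarith [le_ciInf (hlow x)]

variable (M) in
theorem zero_mem_unitBall (Q : VonNeumannAlgebra H) : (default : M.Ball 1) ∈ M.unitBall Q :=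
  zero_mem Q

theorem isFormulaOver_iSup_commutator {N : VonNeumannAlgebra H}
    (h : IsFormulaOver A fun z => Metric.infDist z (M.unitBall N)) :
    IsFormulaOver A fun y => ⨆ z : M.Ball 1,
      (M.norm2 (y.1 * z.1 - z.1 * y.1) + -4 * Metric.infDist z (M.unitBall N)) := by
  rw [isFormulaOver_iff] at h ⊢
  let v0 : Term M A [1, 1] 1 := .var (Γ := [1, 1]) (0 : Fin 2)
  let v1 : Term M A [1, 1] 1 := .var (Γ := [1, 1]) (1 : Fin 2)
  have h1 : IsFormulaIn A [1, 1] (fun v => -4 * Metric.infDist (v (0 : Fin 2)) (M.unitBall N)) :=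
    (h.subst (Δ := [1, 1])
      (Fin.cons (α := fun i : Fin [1].length => Term M A [1, 1] ([1].get i)) v0
        fun i => i.elim0)).const_mul _
  have h2 : IsFormulaIn A [1, 1] (fun v => M.norm2 ((v (1 : Fin 2)).1 * (v (0 : Fin 2)).1
      - (v (0 : Fin 2)).1 * (v (1 : Fin 2)).1)) := by
    have e : (Formula.dist (.mul v1 v0) (.mul v0 v1)).interp = fun v : Assignment M [1, 1] =>
        M.norm2 ((v (1 : Fin 2)).1 * (v (0 : Fin 2)).1 - (v (0 : Fin 2)).1 * (v (1 : Fin 2)).1) :=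
      funext fun v => dist_ball _ _ _
    exact e ▸ .of_formula _
  -- The commutator is at most `4 ‖y‖ ‖z‖₂`, with `‖y‖ ≤ 1` and `‖z‖₂ ≤ 2`.
  refine (h2.add h1).iSup fun v => ⟨8, Set.forall_mem_range.2 fun z => ?_⟩
  change M.norm2 ((v (0 : Fin 1)).1 * z.1 - z.1 * (v (0 : Fin 1)).1)
    + -4 * Metric.infDist z (M.unitBall N) ≤ 8
  have e1 := M.norm2_commutator_le (v (0 : Fin 1)).1 z.1
  have e2 := M.norm_ball_one (v (0 : Fin 1))
  have e3 := M.norm2_ball_one_le z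
  have e4 : (0 : ℝ) ≤ Metric.infDist z (M.unitBall N) := Metric.infDist_nonneg
  nlinarith [M.norm2_nonneg z.1]

/-- For `n ∈ N`, `[y, z] = [y, z - n]`. This is why the penalty coefficient is 4: it makes the
supremum nonpositive on the relative commutant. -/
theorem norm2_commutator_le_infDist {N : VonNeumannAlgebra H} {y : M.Ball 1}
    (hy : y ∈ M.unitBall (relCommutant N M.toVonNeumannAlgebra)) (z : M.Ball 1) :
    M.norm2 (y.1 * z.1 - z.1 * y.1) ≤ 4 * Metric.infDist z (M.unitBall N) := by
  rw [← div_le_iff₀' (by norm_num)]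
  refine (Metric.le_infDist ⟨_, M.zero_mem_unitBall N⟩).2 fun {n} hn => ?_
  rw [div_le_iff₀' (by norm_num), dist_ball]
  have hyn : n.1 * y.1 = y.1 * n.1 := Subtype.ext ((mem_relCommutant.1 hy).1 _ hn)
  have e : y.1 * z.1 - z.1 * y.1 = y.1 * (z.1 - n.1) - (z.1 - n.1) * y.1 := by
    rw [mul_sub, sub_mul, hyn]
    abel
  rw [e]
  refine (M.norm2_commutator_le _ _).trans ?_
  nlinarith [M.norm_ball_one y, M.norm2_nonneg (z.1 - n.1)]

theorem relCommutant_le (N P : VonNeumannAlgebra H) : relCommutant N P ≤ P :=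
  fun _ hx => (mem_relCommutant.1 hx).2

/-- The relative commutant of a definable subalgebra is definable over the same parameters. -/
theorem IsDefinableSubalgebra.relCommutant {N : VonNeumannAlgebra H}
    (hN : M.IsDefinableSubalgebra A N) :
    M.IsDefinableSubalgebra A (relCommutant N M.toVonNeumannAlgebra) := by
  refine ⟨relCommutant_le _ _, M.isClosed_unitBall_relCommutant hN.1,
    isFormulaOver_infDist (Q := M.unitBall _) ⟨_, M.zero_mem_unitBall _⟩ fun ε hε =>
      ⟨_, isFormulaOver_iSup_commutator hN.2.2, fun y hy => ciSup_le fun z => ?_, fun y => ?_⟩⟩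
  · linarith [norm2_commutator_le_infDist hy z]
  · obtain ⟨w, hw, hyw, -⟩ := M.exists_mem_relCommutant y hN.1
    refine (Metric.infDist_le_dist_of_mem (s := M.unitBall _) hw).trans ?_
    rw [dist_ball]
    refine (hyw _ fun u hu huN => ?_).trans (le_add_of_nonneg_right hε.le)
    -- At a unitary of `N` the penalty vanishes, so the supremum dominates `‖[y, u]‖₂`.
    let z : M.Ball 1 := ⟨u, by simpa using M.norm_unitary_le_one hu⟩
    have hz : Metric.infDist z (M.unitBall N) = 0 := Metric.infDist_zero_of_mem huN
    have hbdd : BddAbove (Set.range fun z : M.Ball 1 =>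
        M.norm2 (y.1 * z.1 - z.1 * y.1) + -4 * Metric.infDist z (M.unitBall N)) := by
      refine ⟨8, Set.forall_mem_range.2 fun z => ?_⟩
      have e4 : (0 : ℝ) ≤ Metric.infDist z (M.unitBall N) := Metric.infDist_nonneg
      nlinarith [M.norm2_commutator_le y.1 z.1, M.norm_ball_one y, M.norm2_ball_one_le z,
        M.norm2_nonneg z.1]
    have := le_ciSup hbdd z
    rw [hz, mul_zero, add_zero] at this
    exact this

/-- If `N` has w-spectral gap in `M`, then `N' ∩ M` is definable over `N`. -/
theorem HasWSpectralGap.isDefinableSubalgebra {N : VonNeumannAlgebra H}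
    (hN : N ≤ M.toVonNeumannAlgebra) (h : M.HasWSpectralGap N) :
    M.IsDefinableSubalgebra {a : M.toStarSubalgebra | (a : H →L[ℂ] H) ∈ N}
      (_root_.relCommutant N M.toVonNeumannAlgebra) := by
  refine ⟨relCommutant_le _ _, M.isClosed_unitBall_relCommutant hN,
    isFormulaOver_infDist (Q := M.unitBall _) ⟨_, M.zero_mem_unitBall _⟩ fun ε hε => ?_⟩
  obtain ⟨F, hF, δ, hδ, hgap⟩ := h ε hε
  -- If all commutators are at most `δ`, the gap bounds the distance by `ε`. Otherwise the sum
  -- exceeds `δ`, and the factor `2 / δ` lifts it above 2, which bounds every distance to the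
  -- relative commutant's ball, as that ball contains 0.
  refine ⟨fun y => 2 / δ * ∑ u ∈ F, M.norm2 (y.1 * u - u * y.1), ?_, fun y hy => ?_, fun y => ?_⟩
  · rw [isFormulaOver_iff]
    refine IsFormulaIn.const_mul (.sum F fun u hu => ?_) _
    let v0 : Term M {a : M.toStarSubalgebra | (a : H →L[ℂ] H) ∈ N} [1] 1 :=
      .var (Γ := [1]) (0 : Fin 1)
    let p : Term M {a : M.toStarSubalgebra | (a : H →L[ℂ] H) ∈ N} [1] 1 :=
      .param 1 u (hF u hu).2 (by simpa using M.norm_unitary_le_one (hF u hu).1)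
    have e : (Formula.dist (.mul v0 p) (.mul p v0)).interp = fun v : Assignment M [1] =>
        M.norm2 ((v (0 : Fin 1)).1 * u - u * (v (0 : Fin 1)).1) :=
      funext fun v => dist_ball _ _ _
    exact e ▸ .of_formula _
  · change 2 / δ * ∑ u ∈ F, M.norm2 (y.1 * u - u * y.1) ≤ 0
    rw [Finset.sum_eq_zero, mul_zero]
    intro u hu
    have : u * y.1 = y.1 * u := Subtype.ext ((mem_relCommutant.1 hy).1 _ (hF u hu).2)
    rw [norm2_eq_zero, this, sub_self]
  · have hnn : ∀ u ∈ F, 0 ≤ M.norm2 (y.1 * u - u * y.1) := fun u _ => M.norm2_nonneg _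
    by_cases hy : ∀ u ∈ F, M.norm2 (y.1 * u - u * y.1) ≤ δ
    · obtain ⟨w, hw, -, hyw⟩ := M.exists_mem_relCommutant y hN
      have h1 := hgap y hy
      rw [M.condExp_eq hw hyw, ← map_sub, norm_toL2, ← dist_ball] at h1
      refine ((Metric.infDist_le_dist_of_mem (s := M.unitBall _) hw).trans h1).trans (le_add_of_nonneg_left ?_)
      exact mul_nonneg (by positivity) (Finset.sum_nonneg hnn)
    · push Not at hy
      obtain ⟨u, hu, huδ⟩ := hy
      have h1 : Metric.infDist y (M.unitBall (_root_.relCommutant N M.toVonNeumannAlgebra)) ≤ 2 := by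
        refine (Metric.infDist_le_dist_of_mem (M.zero_mem_unitBall _)).trans ?_
        rw [dist_ball]
        have : y.1 - (default : M.Ball 1).1 = y.1 := sub_zero _
        rw [this]
        exact M.norm2_ball_one_le y
      have h2 := huδ.le.trans (Finset.single_le_sum hnn hu)
      have h3 : 2 ≤ 2 / δ * ∑ u ∈ F, M.norm2 (y.1 * u - u * y.1) := by
        rw [div_mul_eq_mul_div, le_div_iff₀ hδ]
        linarith
      change Metric.infDist y (M.unitBall _) ≤ _
      linarith

end TracialVNA

theorem mainTheorem10 {H : Type*} [NormedAddCommGroup H] [InnerProductSpace ℂ H]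
    [CompleteSpace H] (M : TracialVNA H) (hM : M.IsII1Factor)
    (N : VonNeumannAlgebra H) (hN : N ≤ M.toVonNeumannAlgebra) :
    (∀ A : Set M.toStarSubalgebra, M.IsDefinableSubalgebra A N →
      M.IsDefinableSubalgebra A (relCommutant N M.toVonNeumannAlgebra)) ∧
    (M.HasWSpectralGap N →
      M.IsDefinableSubalgebra {a : M.toStarSubalgebra | (a : H →L[ℂ] H) ∈ N}
        (relCommutant (relCommutant N M.toVonNeumannAlgebra) M.toVonNeumannAlgebra)) := by
  exact ⟨fun _ h => h.relCommutant, fun h => (h.isDefinableSubalgebra hN).relCommutant⟩
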